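/- Let $W^1,W^2$ be real Hilbert spaces, let $\mathrm d:V^1\subset W^1\to W^2$ be a densely defined, closed linear operator with closed range $\mathcal R(\mathrm d)$ and kernel $N(\mathrm d)$, and let $\mathrm d^*:V_2^*\subset W^2\to W^1$ be its adjoint. Let $\alpha,\beta:W^1\to W^1$ and $\gamma:W^2\to W^2$ be bounded, selfadjoint, positive isomorphisms, and for such an isomorphism $\kappa$ write $\|w\|_\kappa=\langle\kappa w,w\rangle^{1/2}$. Consider the abstract damped wave system $$\alpha\,\partial_t u-\mathrm d^*u^*=-\beta u,\qquad \gamma\,\partial_t u^*+\mathrm d u=0,\qquad t\ge 0.$$ A mild solution is a pair $(u,u^*)\in C([0,\infty);W^1\times W^2)$ such that for all $t\ge 0$ the integrals $U(t)=\int_0^t u(r)\,dr$ and $U^*(t)=\int_0^t u^*(r)\,dr$ lie in $V^1$ and $V_2^*$, respectively, and $$\alpha\,(u(t)-u(0))=\mathrm d^*U^*(t)-\beta U(t),\qquad \gamma\,(u^*(t)-u^*(0))=-\mathrm d U(t).$$ Then there exist constants $0<c_\beta\le C_\beta$ and $C_{\mathrm P}\ge 0$ with $$c_\beta\|w\|_\alpha^2\le\|w\|_\beta^2\le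 C_\beta\|w\|_\alpha^2\quad\text{for all } w\in W^1,$$ $$\|w\|_\alpha\le C_{\mathrm P}\,\|\mathrm d w\|_{\gamma^{-1}}\quad\text{for all } w\in V^1 \text{ with } \langle\beta w,z\rangle_{W^1}=0 \text{ for every } z\in N(\mathrm d).$$ Moreover, for any such constants, the number $$\delta^{**}=\min\left(\frac12\,\frac{c_\beta}{2+C_{\mathrm P}c_\beta},\ \frac{c_\beta}{2+2C_\beta/c_\beta+(C_{\mathrm P}C_\beta)^2}\right)$$ is positive, and every mild solution $(u,u^*)$ with $\gamma u^*(0)\in\mathcal R(\mathrm d)$ satisfies $$\|u(t)\|_\alpha^2+\|u^*(t)\|_\gamma^2\le 3\,e^{-\frac23\delta^{**}(t-s)}\left(\|u(s)\|_\alpha^2+\|u^*(s)\|_\gamma^2\right)\qquad\text{for all } 0\le s\le t.$$ In particular, the energy decays exponentially with constants $C'=3$ and $c'=\frac23\delta^{**}>0$ that do not depend on the solution. -/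

import Mathlib

noncomputable section

/-- The norm `‖w‖_a = ⟨a w, w⟩ ^ (1/2)` generated by a selfadjoint positive isomorphism `a`. -/
def weightedNorm {W : Type*} [NormedAddCommGroup W] [InnerProductSpace ℝ W]
    (a : W ≃L[ℝ] W) (w : W) : ℝ :=
  √(inner ℝ (a w) w)

/-- The energy `‖u‖_α² + ‖u*‖_γ²` of a state `(u, u*)`. -/
def waveEnergy {W₁ W₂ : Type*}
    [NormedAddCommGroup W₁] [InnerProductSpace ℝ W₁]
    [NormedAddCommGroup W₂] [InnerProductSpace ℝ W₂]
    (α : W₁ ≃L[ℝ] W₁) (γ : W₂ ≃L[ℝ] W₂) (u : W₁) (v : W₂) : ℝ :=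
  weightedNorm α u ^ 2 + weightedNorm γ v ^ 2

/-- Mild solutions on `[0, ∞)` of the system `α ∂ₜu - d* u* = -β u`, `γ ∂ₜu* + d u = 0`.

This is the usual notion for the evolution equation `∂ₜx = A x` with `x = (u, u*)`,
`A (u, u*) = (α⁻¹ (d* u* - β u), -γ⁻¹ d u)` and `D(A) = D(d) × D(d*)`: the function `x` is
continuous on `[0, ∞)` and for every `t ≥ 0` the integral `X(t)` of `x` over `[0, t]` belongs to
`D(A)` and `x(t) - x(0) = A X(t)`. Both components are multiplied by `α` and `γ`. -/
structure IsMildSolution {W₁ W₂ : Type*}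
    [NormedAddCommGroup W₁] [InnerProductSpace ℝ W₁] [CompleteSpace W₁]
    [NormedAddCommGroup W₂] [InnerProductSpace ℝ W₂]
    (d : W₁ →ₗ.[ℝ] W₂) (α β : W₁ ≃L[ℝ] W₁) (γ : W₂ ≃L[ℝ] W₂)
    (u : ℝ → W₁) (v : ℝ → W₂) : Prop where
  continuousOn_fst : ContinuousOn u (Set.Ici 0)
  continuousOn_snd : ContinuousOn v (Set.Ici 0)
  integral_eq : ∀ t : ℝ, 0 ≤ t →
    ∃ (U : d.domain) (V : d.adjoint.domain),
      (U : W₁) = ∫ r in (0 : ℝ)..t, u r ∧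
      (V : W₂) = ∫ r in (0 : ℝ)..t, v r ∧
      α (u t - u 0) = d.adjoint V - β U ∧
      γ (v t - v 0) = - d U

/-- `c` and `C` are constants of equivalence of the norms generated by `α` and `β`:
`c ‖u‖_α² ≤ ‖u‖_β² ≤ C ‖u‖_α²`. -/
structure IsNormEquivConst {W₁ : Type*} [NormedAddCommGroup W₁] [InnerProductSpace ℝ W₁]
    (α β : W₁ ≃L[ℝ] W₁) (c C : ℝ) : Prop where
  pos : 0 < c
  le : c ≤ C
  lower : ∀ u : W₁, c * weightedNorm α u ^ 2 ≤ weightedNorm β u ^ 2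
  upper : ∀ u : W₁, weightedNorm β u ^ 2 ≤ C * weightedNorm α u ^ 2

/-- `P` is a Poincaré constant: `‖u‖_α ≤ P ‖d u‖_{γ⁻¹}` for all `u` in the domain of `d` that
satisfy `⟨β u, z⟩ = 0` for every `z` in the kernel of `d`. -/
structure IsPoincareConst {W₁ W₂ : Type*}
    [NormedAddCommGroup W₁] [InnerProductSpace ℝ W₁]
    [NormedAddCommGroup W₂] [InnerProductSpace ℝ W₂]
    (d : W₁ →ₗ.[ℝ] W₂) (α β : W₁ ≃L[ℝ] W₁) (γ : W₂ ≃L[ℝ] W₂) (P : ℝ) : Prop where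
  nonneg : 0 ≤ P
  bound : ∀ u : d.domain,
    (∀ z : d.domain, d z = 0 → inner ℝ (β (u : W₁)) (z : W₁) = 0) →
    weightedNorm α (u : W₁) ≤ P * weightedNorm γ.symm (d u)

/-- The number `δ** = min (c / (2 (2 + P c))) (c / (2 + 2 C / c + (P C)²))`. -/
def deltaStarStar (c C P : ℝ) : ℝ :=
  min (1 / 2 * (c / (2 + P * c))) (c / (2 + 2 * C / c + (P * C) ^ 2))

end

/-! Damping acts on `u` only, so the energy `E` alone gives no decay rate for `u*`. Each `y` in the
range of `d` has a potential `G y`, its preimage β-orthogonal to the kernel; by the Poincaré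
inequality `G` is bounded (`exists_potential`). Adding the cross term `-2δ⟨αu, Gγu*⟩` to `E`
produces `-2δ‖u*‖_γ²` in the derivative. For `δ = δ**` the modified energy `F` lies between `E/2`
and `3E/2`, and the remaining terms are absorbed by the damping (`modified_dissipation_le`), so `F'
≤ -δE ≤ -(2/3)δF`.

This needs differentiable solutions. For a mild solution, the estimate is applied to difference
quotients of its primitives, which are strong solutions, and the step size tends to `0`. -/

open Filter Topology

/-! ### Norms and projections generated by positive isomorphisms. -/

section WeightedNorm

variable {W : Type*} [NormedAddCommGroup W] [InnerProductSpace ℝ W]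

lemma inner_map_self_nonneg {a : W ≃L[ℝ] W} (ha : (a : W →L[ℝ] W).IsPositive) (w : W) :
    0 ≤ inner ℝ (a w) w := by
  simpa using ha.inner_nonneg_left w

lemma inner_map_comm {a : W ≃L[ℝ] W} (ha : (a : W →L[ℝ] W).IsPositive) (x y : W) :
    inner ℝ (a x) y = inner ℝ (a y) x := by
  have h := ha.inner_left_eq_inner_right x y
  rw [real_inner_comm x (a y)]
  simpa using h

lemma weightedNorm_nonneg (a : W ≃L[ℝ] W) (w : W) : 0 ≤ weightedNorm a w := Real.sqrt_nonneg _

lemma weightedNorm_sq {a : W ≃L[ℝ] W} (ha : (a : W →L[ℝ] W).IsPositive) (w : W) :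
    weightedNorm a w ^ 2 = inner ℝ (a w) w := Real.sq_sqrt (inner_map_self_nonneg ha w)

lemma weightedNorm_symm_apply (a : W ≃L[ℝ] W) (w : W) :
    weightedNorm a.symm (a w) = weightedNorm a w := by
  simp [weightedNorm, real_inner_comm]

/-- The Cauchy-Schwarz inequality for the inner product generated by `a`. -/
lemma inner_map_sq_le {a : W ≃L[ℝ] W} (ha : (a : W →L[ℝ] W).IsPositive) (x y : W) :
    inner ℝ (a x) y ^ 2 ≤ inner ℝ (a x) x * inner ℝ (a y) y := by
  have key : ∀ t : ℝ, 0 ≤ inner ℝ (a y) y * (t * t) + 2 * inner ℝ (a x) y * t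
      + inner ℝ (a x) x := by
    intro t
    have h := inner_map_self_nonneg ha (x + t • y)
    simp only [map_add, map_smul, inner_add_left, inner_add_right, real_inner_smul_left,
      real_inner_smul_right, inner_map_comm ha y x] at h
    linarith
  have := discrim_le_zero key
  simp only [discrim] at this
  linarith

lemma abs_inner_map_le {a : W ≃L[ℝ] W} (ha : (a : W →L[ℝ] W).IsPositive) (x y : W) :
    |inner ℝ (a x) y| ≤ weightedNorm a x * weightedNorm a y := by
  apply abs_le_of_sq_le_sq _ (mul_nonneg (weightedNorm_nonneg _ _) (weightedNorm_nonneg _ _))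
  rw [mul_pow, weightedNorm_sq ha, weightedNorm_sq ha]
  exact inner_map_sq_le ha x y

lemma inner_map_self_le (a : W ≃L[ℝ] W) (w : W) :
    inner ℝ (a w) w ≤ ‖(a : W →L[ℝ] W)‖ * ‖w‖ ^ 2 := by
  calc inner ℝ (a w) w ≤ ‖a w‖ * ‖w‖ := real_inner_le_norm _ _
    _ ≤ (‖(a : W →L[ℝ] W)‖ * ‖w‖) * ‖w‖ := by
        gcongr
        exact (a : W →L[ℝ] W).le_opNorm w
    _ = _ := by ring

/-- Cauchy-Schwarz for the pair `w`, `a w` gives `‖a w‖² ≤ ‖a‖⟨a w, w⟩`, and bounded invertibility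
controls `‖w‖` by `‖a w‖`. -/
lemma exists_coercive_bound {a : W ≃L[ℝ] W} (ha : (a : W →L[ℝ] W).IsPositive) :
    ∃ m : ℝ, 0 < m ∧ ∀ w, m * ‖w‖ ^ 2 ≤ inner ℝ (a w) w := by
  set A := ‖(a : W →L[ℝ] W)‖ with hA
  set B := ‖(a.symm : W →L[ℝ] W)‖ with hB
  have hA0 : 0 ≤ A := norm_nonneg _
  have hB0 : 0 ≤ B := norm_nonneg _
  have h1 : ∀ w, ‖a w‖ ^ 2 ≤ A * inner ℝ (a w) w := by
    intro w
    have h := inner_map_sq_le ha w (a w)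
    rw [real_inner_self_eq_norm_sq] at h
    have h' := inner_map_self_le a (a w)
    have h0 := inner_map_self_nonneg ha w
    rcases (sq_nonneg ‖a w‖).eq_or_lt with h2 | h2
    · rw [← h2]
      positivity
    · refine le_of_mul_le_mul_right ?_ h2
      nlinarith [mul_le_mul_of_nonneg_left h' h0]
  have h2 : ∀ w, ‖w‖ ^ 2 ≤ B ^ 2 * ‖a w‖ ^ 2 := by
    intro w
    have h := (a.symm : W →L[ℝ] W).le_opNorm (a w)
    simp only [ContinuousLinearEquiv.coe_coe, ContinuousLinearEquiv.symm_apply_apply] at h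
    rw [← mul_pow]
    gcongr
  -- The summand `1` covers the trivial space, where `A` and `B` vanish.
  refine ⟨(B ^ 2 * A + 1)⁻¹, by positivity, fun w => ?_⟩
  have h0 := inner_map_self_nonneg ha w
  rw [inv_mul_le_iff₀ (by positivity)]
  nlinarith [h2 w, mul_le_mul_of_nonneg_left (h1 w) (sq_nonneg B)]

lemma exists_isNormEquivConst {a b : W ≃L[ℝ] W} (ha : (a : W →L[ℝ] W).IsPositive)
    (hb : (b : W →L[ℝ] W).IsPositive) : ∃ c C : ℝ, IsNormEquivConst a b c C := by
  have key : ∀ {a b : W ≃L[ℝ] W}, (a : W →L[ℝ] W).IsPositive → (b : W →L[ℝ] W).IsPositive →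
      ∃ K : ℝ, 0 < K ∧ ∀ w, weightedNorm a w ^ 2 ≤ K * weightedNorm b w ^ 2 := by
    intro a b ha hb
    obtain ⟨m, hm, h⟩ := exists_coercive_bound hb
    refine ⟨(‖(a : W →L[ℝ] W)‖ + 1) / m, by positivity, fun w => ?_⟩
    rw [weightedNorm_sq ha, weightedNorm_sq hb, div_mul_eq_mul_div, le_div_iff₀ hm]
    have h1 := inner_map_self_le a w
    have h2 := norm_nonneg (a : W →L[ℝ] W)
    have h3 := inner_map_self_nonneg hb w
    nlinarith [h w, mul_le_mul_of_nonneg_left (h w) h2]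
  obtain ⟨K, hK, h⟩ := key ha hb
  obtain ⟨L, hL, h'⟩ := key hb ha
  refine ⟨K⁻¹, max L K⁻¹, inv_pos.2 hK, le_max_right _ _, fun w => ?_, fun w => ?_⟩
  · rw [inv_mul_le_iff₀ hK]
    exact h w
  · exact (h' w).trans (mul_le_mul_of_nonneg_right (le_max_left _ _) (sq_nonneg _))

/-- The projection onto the complement of a closed subspace that is orthogonal with respect to the
inner product generated by `b`. -/
lemma exists_complement_projection [CompleteSpace W] {b : W ≃L[ℝ] W}
    (hb : (b : W →L[ℝ] W).IsPositive) (N : Submodule ℝ W) (hN : IsClosed (N : Set W)) :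
    ∃ Q : W →L[ℝ] W, ∀ w, w - Q w ∈ N ∧ ∀ z ∈ N, inner ℝ (b (Q w)) z = 0 := by
  have : CompleteSpace N := hN.completeSpace_coe
  let A : N →L[ℝ] N := N.orthogonalProjectionOnto ∘L (b : W →L[ℝ] W) ∘L N.subtypeL
  let B : N →L[ℝ] N →L[ℝ] ℝ := (innerSL ℝ) ∘L A
  have hproj : ∀ (w : W) (z : N), inner ℝ (N.orthogonalProjectionOnto w) z = inner ℝ w (z : W) := by
    intro w z
    simp
  have hB : ∀ x y : N, B x y = inner ℝ (b (x : W)) (y : W) := fun x y => hproj _ _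
  have hco : IsCoercive B := by
    obtain ⟨m, hm, h⟩ := exists_coercive_bound hb
    refine ⟨m, hm, fun x => ?_⟩
    rw [hB, mul_assoc, ← sq]
    exact h x
  -- Lax-Milgram inverts the compression of `b` to `N`; then `T⁻¹ Π b` is the b-orthogonal
  -- projection onto `N`, and `Q` is its complement.
  let T := hco.continuousLinearEquivOfBilin
  refine ⟨ContinuousLinearMap.id ℝ W - N.subtypeL ∘L (T.symm : N →L[ℝ] N) ∘L
    N.orthogonalProjectionOnto ∘L (b : W →L[ℝ] W), fun w => ⟨by simp, fun z hz => ?_⟩⟩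
  have h := hco.continuousLinearEquivOfBilin_apply
    (T.symm (N.orthogonalProjectionOnto (b w))) ⟨z, hz⟩
  rw [hB] at h
  change inner ℝ (T (T.symm _)) _ = _ at h
  rw [ContinuousLinearEquiv.apply_symm_apply, hproj] at h
  simp only [sub_apply, ContinuousLinearMap.comp_apply, map_sub,
    inner_sub_left, ContinuousLinearMap.id_apply, ContinuousLinearEquiv.coe_coe,
    Submodule.subtypeL_apply]
  rw [← h, sub_self]

end WeightedNorm

/-! ### Closed range and the Poincaré inequality. -/

section ClosedRange

variable {W₁ W₂ : Type*} [NormedAddCommGroup W₁] [InnerProductSpace ℝ W₁] [CompleteSpace W₁]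
  [NormedAddCommGroup W₂] [InnerProductSpace ℝ W₂] [CompleteSpace W₂]

/-- Open mapping theorem for the second projection from the graph onto the range, both Banach
spaces. -/
lemma LinearPMap.IsClosed.exists_preimage_norm_le {d : W₁ →ₗ.[ℝ] W₂} (hd : d.IsClosed)
    (hr : _root_.IsClosed (LinearMap.range d.toFun : Set W₂)) :
    ∃ M : ℝ, 0 < M ∧ ∀ x : d.domain, ∃ y : d.domain, d y = d x ∧ ‖(y : W₁)‖ ≤ M * ‖d x‖ := by
  have hd' : _root_.IsClosed (d.graph : Set (W₁ × W₂)) := hd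
  have : CompleteSpace d.graph := hd'.completeSpace_coe
  have : CompleteSpace (LinearMap.range d.toFun) := hr.completeSpace_coe
  let f : d.graph →L[ℝ] LinearMap.range d.toFun :=
    ((ContinuousLinearMap.snd ℝ W₁ W₂) ∘L d.graph.subtypeL).codRestrict _ (by
      rintro ⟨⟨x, y⟩, h⟩
      obtain ⟨z, -, hz⟩ := d.mem_graph_iff.1 h
      exact ⟨z, hz⟩)
  have hf : Function.Surjective f := by
    rintro ⟨_, x, rfl⟩
    exact ⟨⟨_, d.mem_graph x⟩, rfl⟩
  obtain ⟨M, hM, h⟩ := f.exists_preimage_norm_le hf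
  refine ⟨M, hM, fun x => ?_⟩
  obtain ⟨⟨⟨y, y'⟩, hy⟩, hfy, hn⟩ := h ⟨d x, x, rfl⟩
  obtain ⟨z, hz, hz'⟩ := d.mem_graph_iff.1 hy
  have hfy' : y' = d x := congrArg Subtype.val hfy
  refine ⟨z, hz'.trans hfy', ?_⟩
  have hz'' : (z : W₁) = y := hz
  rw [hz'']
  exact (norm_fst_le (y, y')).trans hn

/-- A vector β-orthogonal to the kernel has the least β-norm among all preimages of its image, so it
is dominated by the preimage that the open mapping theorem bounds. -/
lemma exists_isPoincareConst {d : W₁ →ₗ.[ℝ] W₂} (hd : d.IsClosed)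
    (hr : IsClosed (LinearMap.range d.toFun : Set W₂)) {α β : W₁ ≃L[ℝ] W₁} {γ : W₂ ≃L[ℝ] W₂}
    (hα : (α : W₁ →L[ℝ] W₁).IsPositive) (hβ : (β : W₁ →L[ℝ] W₁).IsPositive)
    (hγ : (γ : W₂ →L[ℝ] W₂).IsPositive) : ∃ P, IsPoincareConst d α β γ P := by
  obtain ⟨M, hM, h⟩ := hd.exists_preimage_norm_le hr
  obtain ⟨c, C, hc⟩ := exists_isNormEquivConst hα hβ
  obtain ⟨m, hm, hm'⟩ := exists_coercive_bound hγ
  set A := ‖(β : W₁ →L[ℝ] W₁)‖ with hA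
  set B := ‖(γ : W₂ →L[ℝ] W₂)‖ with hB
  set K := A * M ^ 2 * (B ^ 2 / m) / c with hK
  have hc0 := hc.pos
  refine ⟨√K, Real.sqrt_nonneg _, fun x hx => ?_⟩
  obtain ⟨y, hy, hyn⟩ := h x
  have hz : d (x - y) = 0 := by rw [d.map_sub, hy, sub_self]
  have hxy : inner ℝ (β (x : W₁)) (x : W₁) = inner ℝ (β (x : W₁)) (y : W₁) := by
    have := hx _ hz
    rw [Submodule.coe_sub, inner_sub_right] at this
    linarith
  have h1 : inner ℝ (β (x : W₁)) (x : W₁) ≤ inner ℝ (β (y : W₁)) (y : W₁) := by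
    have h := inner_map_sq_le hβ (x : W₁) (y : W₁)
    rw [← hxy, sq] at h
    have h0 := inner_map_self_nonneg hβ (x : W₁)
    rcases h0.eq_or_lt with h2 | h2
    · rw [← h2]
      exact inner_map_self_nonneg hβ _
    · exact le_of_mul_le_mul_left h h2
  have h2 : inner ℝ (β (y : W₁)) (y : W₁) ≤ A * (M * ‖d x‖) ^ 2 :=
    (inner_map_self_le β _).trans (by gcongr)
  obtain ⟨g, hg⟩ := γ.surjective (d x)
  have h3 : ‖d x‖ ^ 2 ≤ B ^ 2 / m * weightedNorm γ g ^ 2 := by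
    rw [weightedNorm_sq hγ, ← hg, div_mul_eq_mul_div, le_div_iff₀ hm]
    have h4 : ‖γ g‖ ^ 2 ≤ B ^ 2 * ‖g‖ ^ 2 := by
      rw [← mul_pow]
      gcongr
      exact (γ : W₂ →L[ℝ] W₂).le_opNorm g
    nlinarith [mul_le_mul_of_nonneg_left (hm' g) (sq_nonneg B)]
  rw [← hg, weightedNorm_symm_apply]
  refine (sq_le_sq₀ (weightedNorm_nonneg _ _)
    (mul_nonneg (Real.sqrt_nonneg _) (weightedNorm_nonneg _ _))).1 ?_
  rw [mul_pow, Real.sq_sqrt (by positivity), hK, div_mul_eq_mul_div, le_div_iff₀ hc0, mul_comm]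
  refine (hc.lower x).trans ?_
  rw [weightedNorm_sq hβ]
  refine (h1.trans h2).trans ?_
  rw [mul_pow, ← mul_assoc, mul_assoc (A * M ^ 2)]
  gcongr

end ClosedRange

/-! ### The constant `δ**`, the modified energy and strong solutions. -/

section Decay

variable {W₁ W₂ : Type*} [NormedAddCommGroup W₁] [InnerProductSpace ℝ W₁]
  [NormedAddCommGroup W₂] [InnerProductSpace ℝ W₂]

lemma deltaStarStar_pos {c C P : ℝ} (hc : 0 < c) (hC : c ≤ C) (hP : 0 ≤ P) :
    0 < deltaStarStar c C P := by
  have hC' : 0 < C := hc.trans_le hC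
  unfold deltaStarStar
  positivity

/-- Keeps the cross term below half of the energy. -/
lemma deltaStarStar_mul_le {c C P : ℝ} (hc : 0 < c) (hP : 0 ≤ P) :
    deltaStarStar c C P * P ≤ 1 / 2 := by
  have h : deltaStarStar c C P ≤ 1 / 2 * (c / (2 + P * c)) := min_le_left _ _
  refine (mul_le_mul_of_nonneg_right h hP).trans ?_
  rw [mul_assoc, div_mul_eq_mul_div c]
  have : c * P / (2 + P * c) ≤ 1 := by
    rw [div_le_one (by positivity)]
    linarith
  linarith

lemma deltaStarStar_mul_le' {c C P : ℝ} (hc : 0 < c) (hC : c ≤ C) (hP : 0 ≤ P) :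
    deltaStarStar c C P * (4 + (P * C) ^ 2) ≤ c := by
  have hC' : 0 < C := hc.trans_le hC
  have h : deltaStarStar c C P ≤ c / (2 + 2 * C / c + (P * C) ^ 2) := min_le_right _ _
  rw [le_div_iff₀ (by positivity)] at h
  refine le_trans (mul_le_mul_of_nonneg_left ?_ (deltaStarStar_pos hc hC hP).le) h
  have : 2 ≤ 2 * C / c := by
    rw [le_div_iff₀ hc]
    linarith
  linarith

/-- The dissipation estimate for the energy modified by the cross term `-2 δ ⟨α u, w⟩`. -/
lemma modified_dissipation_le {c C P δ a b g X Y : ℝ} (hc : 0 < c) (hC : c ≤ C)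
    (hδ : 0 ≤ δ) (hδc : δ * (4 + (P * C) ^ 2) ≤ c)
    (hab : c * a ≤ b) (hb : 0 ≤ b) (hg : 0 ≤ g) (hX : c * X ≤ b) (hY : Y ^ 2 ≤ b * (C * P ^ 2 * g)) :
    -2 * b - 2 * δ * g + 2 * δ * Y + 2 * δ * X ≤ -δ * (a + g) := by
  have hC' : 0 < C := hc.trans_le hC
  -- Young's inequality, weighted so that `g` has coefficient exactly `1`.
  have hY' : 2 * Y ≤ C * P ^ 2 * b + g := by
    refine le_trans (le_abs_self _) (abs_le_of_sq_le_sq ?_ (by positivity))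
    nlinarith [sq_nonneg (C * P ^ 2 * b - g)]
  have h1 : c * (C * P ^ 2) ≤ (P * C) ^ 2 := by
    nlinarith [mul_le_mul_of_nonneg_right hC (by positivity : 0 ≤ C * P ^ 2)]
  have h2 : c * (2 * Y + 2 * X + a) ≤ (3 + (P * C) ^ 2) * b + c * g := by
    nlinarith [mul_le_mul_of_nonneg_left hY' hc.le, mul_le_mul_of_nonneg_right h1 hb]
  have h3 : c * (δ * (2 * Y + 2 * X + a)) ≤ c * (2 * b + δ * g) := by
    nlinarith [mul_le_mul_of_nonneg_left h2 hδ, mul_le_mul_of_nonneg_right hδc hb,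
      mul_nonneg hδ hb, mul_nonneg hc.le hb]
  linarith [le_of_mul_le_mul_left h3 hc]

lemma exp_mul_le_of_hasDerivAt {F F' : ℝ → ℝ} {k : ℝ} (hF : ∀ t, HasDerivAt F (F' t) t)
    (hle : ∀ t, 0 ≤ t → F' t ≤ -k * F t) {s t : ℝ} (hs : 0 ≤ s) (hst : s ≤ t) :
    F t ≤ Real.exp (-k * (t - s)) * F s := by
  have hd : ∀ t, HasDerivAt (fun r => Real.exp (k * r) * F r)
      (Real.exp (k * t) * (k * 1) * F t + Real.exp (k * t) * F' t) t := fun t =>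
    (((hasDerivAt_id t).const_mul k).exp).mul (hF t)
  have hanti : AntitoneOn (fun r => Real.exp (k * r) * F r) (Set.Ici 0) := by
    refine antitoneOn_of_deriv_nonpos (convex_Ici 0)
      (fun r _ => (hd r).continuousAt.continuousWithinAt)
      (fun r _ => (hd r).differentiableAt.differentiableWithinAt) fun r hr => ?_
    rw [(hd r).deriv]
    have hr' : 0 ≤ r := interior_subset hr
    nlinarith [hle r hr', Real.exp_pos (k * r),
      mul_le_mul_of_nonneg_left (hle r hr') (Real.exp_pos (k * r)).le]
  have h := hanti hs (hs.trans hst) hst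
  have h' := mul_le_mul_of_nonneg_left h (Real.exp_pos (-(k * t))).le
  simp only [← mul_assoc, ← Real.exp_add] at h'
  rw [neg_add_cancel, Real.exp_zero, one_mul] at h'
  rwa [show -k * (t - s) = -(k * t) + k * s by ring]

lemma hasDerivAt_inner_map_self {W : Type*} [NormedAddCommGroup W] [InnerProductSpace ℝ W]
    {a : W ≃L[ℝ] W} (ha : (a : W →L[ℝ] W).IsPositive) {f : ℝ → W} {f' : W} {t : ℝ}
    (hf : HasDerivAt f f' t) :
    HasDerivAt (fun r => inner ℝ (a (f r)) (f r)) (2 * inner ℝ (a f') (f t)) t := by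
  have h : HasDerivAt (fun r => a (f r)) (a f') t :=
    (a : W →L[ℝ] W).hasFDerivAt.comp_hasDerivAt t hf
  refine (h.inner ℝ hf).congr_deriv ?_
  rw [inner_map_comm ha (f t) f']
  ring

lemma waveEnergy_eq {α : W₁ ≃L[ℝ] W₁} {γ : W₂ ≃L[ℝ] W₂} (hα : (α : W₁ →L[ℝ] W₁).IsPositive)
    (hγ : (γ : W₂ →L[ℝ] W₂).IsPositive) (u : W₁) (v : W₂) :
    waveEnergy α γ u v = inner ℝ (α u) u + inner ℝ (γ v) v := by
  rw [waveEnergy, weightedNorm_sq hα, weightedNorm_sq hγ]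

/-- Carries the decay estimate from difference quotients of primitives to the mild solution itself.
-/
lemma tendsto_waveEnergy_slope {α : W₁ ≃L[ℝ] W₁} {γ : W₂ ≃L[ℝ] W₂}
    (hα : (α : W₁ →L[ℝ] W₁).IsPositive) (hγ : (γ : W₂ →L[ℝ] W₂).IsPositive)
    {U : ℝ → W₁} {V : ℝ → W₂} {u : W₁} {v : W₂} {t : ℝ} (hU : HasDerivAt U u t)
    (hV : HasDerivAt V v t) :
    Tendsto (fun h : ℝ => waveEnergy α γ (h⁻¹ • (U (t + h) - U t)) (h⁻¹ • (V (t + h) - V t)))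
      (𝓝[>] 0) (𝓝 (waveEnergy α γ u v)) := by
  have hu := hU.tendsto_slope_zero_right
  have hv := hV.tendsto_slope_zero_right
  simp only [waveEnergy_eq hα hγ]
  exact (((α.continuous.tendsto u).comp hu).inner hu).add
    (((γ.continuous.tendsto v).comp hv).inner hv)

variable [CompleteSpace W₁] [CompleteSpace W₂]

/-- The potential `G y` of `y` in the range of `d`: the preimage of `y` that is orthogonal to the
kernel of `d` in the inner product generated by `β`. -/
lemma exists_potential {d : W₁ →ₗ.[ℝ] W₂} (hd : d.IsClosed)
    (hr : IsClosed (LinearMap.range d.toFun : Set W₂)) {α β : W₁ ≃L[ℝ] W₁} {γ : W₂ ≃L[ℝ] W₂}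
    (hα : (α : W₁ →L[ℝ] W₁).IsPositive) (hβ : (β : W₁ →L[ℝ] W₁).IsPositive)
    {P : ℝ} (hP : IsPoincareConst d α β γ P) :
    ∃ G : W₂ →L[ℝ] W₁, ∀ x : d.domain, ∃ w : d.domain, (w : W₁) = G (d x) ∧ d w = d x ∧
      ∀ z : d.domain, d z = 0 → inner ℝ (β (w : W₁)) (z : W₁) = 0 := by
  have hd' : IsClosed (d.graph : Set (W₁ × W₂)) := hd
  let N : Submodule ℝ W₁ := d.graph.comap (LinearMap.inl ℝ W₁ W₂)
  -- The kernel is a slice of the closed graph.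
  have hN : IsClosed (N : Set W₁) := hd'.preimage (ContinuousLinearMap.inl ℝ W₁ W₂).continuous
  have memN : ∀ z, z ∈ N ↔ ∃ x : d.domain, (x : W₁) = z ∧ d x = 0 := fun z => d.mem_graph_iff
  obtain ⟨Q, hQ⟩ := exists_complement_projection hβ N hN
  have hQd : ∀ x : d.domain, ∃ w : d.domain, (w : W₁) = Q x ∧ d w = d x ∧
      ∀ z : d.domain, d z = 0 → inner ℝ (β (w : W₁)) (z : W₁) = 0 := by
    intro x
    obtain ⟨hx, hx'⟩ := hQ x
    obtain ⟨n, hn, hn'⟩ := (memN _).1 hx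
    have hw : ((x - n : d.domain) : W₁) = Q x := by
      rw [Submodule.coe_sub, hn]
      abel
    refine ⟨x - n, hw, by rw [d.map_sub, hn', sub_zero], fun z hz => ?_⟩
    rw [hw]
    exact hx' _ ((memN _).2 ⟨z, rfl, hz⟩)
  have hQ0 : ∀ x : d.domain, d x = 0 → Q x = 0 := by
    intro x hx
    obtain ⟨w, hw, hw', hw''⟩ := hQd x
    have h := hP.bound w hw''
    obtain ⟨m, hm, hm'⟩ := exists_coercive_bound hα
    have h0 : weightedNorm α (w : W₁) = 0 := by
      refine le_antisymm (h.trans_eq ?_) (weightedNorm_nonneg _ _)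
      simp [hw', hx, weightedNorm]
    have h1 := hm' w
    rw [← weightedNorm_sq hα, h0] at h1
    have h2 : ‖(w : W₁)‖ ^ 2 ≤ 0 := by nlinarith
    rw [← hw]
    simpa using le_antisymm h2 (sq_nonneg _)
  have : CompleteSpace (LinearMap.range d.toFun) := hr.completeSpace_coe
  -- This linear section need not be bounded; `Q ∘ g` is, because `Q` takes the same value on all
  -- preimages, including the one of controlled norm.
  obtain ⟨g, hg⟩ := d.toFun.rangeRestrict.exists_rightInverse_of_surjective
    (LinearMap.range_rangeRestrict _)
  have hg' : ∀ y : LinearMap.range d.toFun, d (g y) = y := fun y =>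
    congrArg Subtype.val (LinearMap.congr_fun hg y)
  have hQg : ∀ x y : d.domain, d x = d y → Q x = Q y := by
    intro x y hxy
    have := hQ0 (x - y) (by rw [d.map_sub, hxy, sub_self])
    rwa [Submodule.coe_sub, map_sub, sub_eq_zero] at this
  obtain ⟨M, hM, hMd⟩ := hd.exists_preimage_norm_le hr
  let G₀ : LinearMap.range d.toFun →L[ℝ] W₁ :=
    ((Q : W₁ →ₗ[ℝ] W₁) ∘ₗ d.domain.subtype ∘ₗ g).mkContinuous (‖Q‖ * M) (by
      intro y
      obtain ⟨x, hx, hxM⟩ := hMd (g y)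
      have h1 : Q (g y) = Q x := hQg _ _ hx.symm
      rw [hg'] at hxM
      change ‖Q (g y)‖ ≤ _
      rw [h1, mul_assoc]
      exact (Q.le_opNorm _).trans (mul_le_mul_of_nonneg_left hxM (norm_nonneg _)))
  -- Orthogonal projection extends the potential to all of `W₂`, so `G (γ (v t))` can be
  -- differentiated without a range condition.
  refine ⟨G₀ ∘L (LinearMap.range d.toFun).orthogonalProjectionOnto, fun x => ?_⟩
  obtain ⟨w, hw, h⟩ := hQd x
  refine ⟨w, ?_, h⟩
  have hx : d x ∈ LinearMap.range d.toFun := ⟨x, rfl⟩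
  have hproj : (LinearMap.range d.toFun).orthogonalProjectionOnto (d x) = ⟨d x, hx⟩ :=
    Submodule.orthogonalProjectionOnto_mem_subspace_eq_self
      (⟨d x, hx⟩ : LinearMap.range d.toFun)
  rw [hw, ContinuousLinearMap.comp_apply, hproj]
  exact hQg _ _ (hg' ⟨d x, hx⟩).symm

/-- Exponential decay for strong solutions. -/
lemma waveEnergy_le_of_hasDerivAt {d : W₁ →ₗ.[ℝ] W₂} (hdense : Dense (d.domain : Set W₁))
    (hd : d.IsClosed) (hr : IsClosed (LinearMap.range d.toFun : Set W₂))
    {α β : W₁ ≃L[ℝ] W₁} {γ : W₂ ≃L[ℝ] W₂}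
    (hα : (α : W₁ →L[ℝ] W₁).IsPositive) (hβ : (β : W₁ →L[ℝ] W₁).IsPositive)
    (hγ : (γ : W₂ →L[ℝ] W₂).IsPositive) {c C P : ℝ} (hc : IsNormEquivConst α β c C)
    (hP : IsPoincareConst d α β γ P) {u u' : ℝ → W₁} {v v' : ℝ → W₂}
    (hu : ∀ t, HasDerivAt u (u' t) t) (hv : ∀ t, HasDerivAt v (v' t) t)
    (heq : ∀ t, 0 ≤ t → ∃ (x : d.domain) (y : d.adjoint.domain), (x : W₁) = u t ∧
      (y : W₂) = v t ∧ α (u' t) = d.adjoint y - β (x : W₁) ∧ γ (v' t) = -d x)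
    (hrange : ∀ t, 0 ≤ t → γ (v t) ∈ LinearMap.range d.toFun) {s t : ℝ} (hs : 0 ≤ s)
    (hst : s ≤ t) :
    waveEnergy α γ (u t) (v t) ≤ 3 * Real.exp (-(2 / 3 * deltaStarStar c C P) * (t - s)) *
      waveEnergy α γ (u s) (v s) := by
  obtain ⟨G, hG⟩ := exists_potential hd hr hα hβ hP
  set δ := deltaStarStar c C P with hδ
  have hδ0 : 0 < δ := deltaStarStar_pos hc.pos hc.le hP.nonneg
  have hδP : δ * P ≤ 1 / 2 := deltaStarStar_mul_le hc.pos hP.nonneg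
  have hδc : δ * (4 + (P * C) ^ 2) ≤ c := deltaStarStar_mul_le' hc.pos hc.le hP.nonneg
  have hC0 : 0 < C := hc.pos.trans_le hc.le
  let E : ℝ → ℝ := fun t => inner ℝ (α (u t)) (u t) + inner ℝ (γ (v t)) (v t)
  let F : ℝ → ℝ := fun t => E t - 2 * δ * inner ℝ (α (u t)) (G (γ (v t)))
  let F' : ℝ → ℝ := fun t => 2 * inner ℝ (α (u' t)) (u t) + 2 * inner ℝ (γ (v' t)) (v t) -
    2 * δ * (inner ℝ (α (u t)) (G (γ (v' t))) + inner ℝ (α (u' t)) (G (γ (v t))))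
  have hF : ∀ t, HasDerivAt F (F' t) t := by
    intro t
    have h1 : HasDerivAt (fun r => α (u r)) (α (u' t)) t :=
      (α : W₁ →L[ℝ] W₁).hasFDerivAt.comp_hasDerivAt t (hu t)
    have h2 : HasDerivAt (fun r => G (γ (v r))) (G (γ (v' t))) t :=
      (G ∘L (γ : W₂ →L[ℝ] W₂)).hasFDerivAt.comp_hasDerivAt t (hv t)
    exact ((hasDerivAt_inner_map_self hα (hu t)).add (hasDerivAt_inner_map_self hγ (hv t))).sub
      ((h1.inner ℝ h2).const_mul (2 * δ))
  have hE : ∀ t, waveEnergy α γ (u t) (v t) = E t := fun t => waveEnergy_eq hα hγ _ _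
  have hpot : ∀ t, 0 ≤ t → ∃ w : d.domain, (w : W₁) = G (γ (v t)) ∧ d w = γ (v t) ∧
      weightedNorm α (w : W₁) ≤ P * weightedNorm γ (v t) := by
    intro t ht
    obtain ⟨x, hx⟩ := hrange t ht
    obtain ⟨w, hw, hwx, hw'⟩ := hG x
    have hx' : d x = γ (v t) := hx
    rw [hx'] at hw hwx
    refine ⟨w, hw, hwx, ?_⟩
    have h := hP.bound w hw'
    rwa [hwx, weightedNorm_symm_apply] at h
  have hcross : ∀ t, 0 ≤ t → |2 * δ * inner ℝ (α (u t)) (G (γ (v t)))| ≤ 1 / 2 * E t := by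
    intro t ht
    obtain ⟨w, hw, -, hwP⟩ := hpot t ht
    have h := abs_inner_map_le hα (u t) (w : W₁)
    have ha := weightedNorm_nonneg α (u t)
    have hg := weightedNorm_nonneg γ (v t)
    rw [← hw, ← hE, waveEnergy, abs_mul, abs_of_pos (by positivity : 0 < 2 * δ)]
    calc 2 * δ * |inner ℝ (α (u t)) (w : W₁)|
        ≤ 2 * δ * (weightedNorm α (u t) * (P * weightedNorm γ (v t))) := by
          gcongr
          exact h.trans (by gcongr)
      _ = δ * P * (2 * (weightedNorm α (u t) * weightedNorm γ (v t))) := by ring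
      _ ≤ 1 / 2 * (weightedNorm α (u t) ^ 2 + weightedNorm γ (v t) ^ 2) := by
          refine mul_le_mul hδP ?_ (by positivity) (by norm_num)
          nlinarith [sq_nonneg (weightedNorm α (u t) - weightedNorm γ (v t))]
  have hdiss : ∀ t, 0 ≤ t → F' t ≤ -(2 / 3 * δ) * F t := by
    intro t ht
    suffices h : F' t ≤ -δ * E t by
      have h1 := (abs_le.1 (hcross t ht)).1
      have h2 : F t ≤ 3 / 2 * E t := by
        simp only [F]
        linarith
      nlinarith [mul_le_mul_of_nonneg_left h2 hδ0.le]
    obtain ⟨x, y, hx, hy, hxy, hyx⟩ := heq t ht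
    obtain ⟨w, hw, hwv, hwP⟩ := hpot t ht
    obtain ⟨q, hq, hqx, hq'⟩ := hG x
    have hadj : ∀ z : d.domain, inner ℝ (d.adjoint y) (z : W₁) = inner ℝ (y : W₂) (d z) :=
      fun z => d.adjoint_isFormalAdjoint hdense y z
    -- `q` is `x` minus its β-orthogonal kernel part, so its β-norm does not exceed that of `x`.
    have hqb : weightedNorm β (q : W₁) ^ 2 ≤ weightedNorm β (x : W₁) ^ 2 := by
      have hz := hq' (q - x) (by rw [d.map_sub, hqx, sub_self])
      rw [Submodule.coe_sub, inner_sub_right, sub_eq_zero] at hz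
      rw [weightedNorm_sq hβ, weightedNorm_sq hβ]
      have h0 := inner_map_self_nonneg hβ ((x - q : d.domain) : W₁)
      rw [Submodule.coe_sub, map_sub, inner_sub_left, inner_sub_right, inner_sub_right,
        inner_map_comm hβ (x : W₁) (q : W₁), ← hz] at h0
      linarith
    have hX : c * inner ℝ (α (x : W₁)) (q : W₁) ≤ weightedNorm β (x : W₁) ^ 2 := by
      have h1 := (le_abs_self _).trans (abs_inner_map_le hα (x : W₁) (q : W₁))
      have h2 := hc.lower x
      have h3 := hc.lower q
      nlinarith [mul_le_mul_of_nonneg_left h1 hc.pos.le, mul_nonneg hc.pos.le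
        (sq_nonneg (weightedNorm α (x : W₁) - weightedNorm α (q : W₁)))]
    have hY : inner ℝ (β (x : W₁)) (w : W₁) ^ 2 ≤ weightedNorm β (x : W₁) ^ 2 *
        (C * P ^ 2 * weightedNorm γ (v t) ^ 2) := by
      refine (inner_map_sq_le hβ _ _).trans ?_
      rw [← weightedNorm_sq hβ, ← weightedNorm_sq hβ, mul_assoc C, ← mul_pow P]
      gcongr
      refine (hc.upper w).trans ?_
      gcongr
      exact weightedNorm_nonneg _ _
    have hmain := modified_dissipation_le (a := weightedNorm α (x : W₁) ^ 2) hc.pos hc.le hδ0.le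
      hδc (hc.lower x) (sq_nonneg _) (sq_nonneg _) hX hY
    -- The `d`, `d*` terms of `E'` cancel. In the cross term `⟨d* y, w⟩ = ⟨y, d w⟩ = ‖v‖_γ²`, and `G
    -- (γ v') = -q`.
    have hFt : F' t = -2 * weightedNorm β (x : W₁) ^ 2 - 2 * δ * weightedNorm γ (v t) ^ 2 +
        2 * δ * inner ℝ (β (x : W₁)) (w : W₁) + 2 * δ * inner ℝ (α (x : W₁)) (q : W₁) := by
      simp only [F']
      rw [hyx, hxy, map_neg, ← hq, ← hw, ← hx, ← hy, inner_sub_left, inner_sub_left, hadj, hadj,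
        hwv, ← hy, inner_neg_left, inner_neg_right, weightedNorm_sq hβ, weightedNorm_sq hγ,
        real_inner_comm (d x), real_inner_comm (γ (y : W₂))]
      ring
    rw [hFt, ← hE, waveEnergy, ← hx]
    exact hmain
  have hexp := exp_mul_le_of_hasDerivAt hF hdiss hs hst
  have h1 := (abs_le.1 (hcross t (hs.trans hst))).2
  have h2 := (abs_le.1 (hcross s hs)).1
  have h3 : 1 / 2 * E t ≤ F t := by
    simp only [F]
    linarith
  have h4 : F s ≤ 3 / 2 * E s := by
    simp only [F]
    linarith
  rw [hE, hE]
  -- The factor `3` is the ratio of `3/2` to `1/2`.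
  nlinarith [mul_le_mul_of_nonneg_left h4 (Real.exp_pos (-(2 / 3 * δ) * (t - s))).le]

/-! ### From strong to mild solutions. -/

/-- The integral of a continuous function with values in a closed subspace. -/
lemma intervalIntegral_mem_of_isClosed {W : Type*} [NormedAddCommGroup W] [InnerProductSpace ℝ W]
    [CompleteSpace W] {R : Submodule ℝ W} (hR : IsClosed (R : Set W)) {f : ℝ → W}
    (hf : Continuous f) {a b : ℝ} (hab : a ≤ b) (h : ∀ r, a ≤ r → f r ∈ R) :
    ∫ r in a..b, f r ∈ R := by
  have : CompleteSpace R := hR.completeSpace_coe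
  -- A closed `R` equals its double complement, so it suffices to integrate the vanishing inner
  -- products with `y`.
  rw [← R.orthogonal_orthogonal, Submodule.mem_orthogonal]
  intro y hy
  have h1 := (innerSL ℝ y).intervalIntegral_comp_comm 
    (hf.intervalIntegrable (μ := MeasureTheory.volume) a b)
  rw [innerSL_apply_apply] at h1
  rw [← h1]
  refine (intervalIntegral.integral_congr (g := fun _ => (0 : ℝ)) fun r hr => ?_).trans (by simp)
  rw [Set.uIcc_of_le hab] at hr
  exact Submodule.inner_left_of_mem_orthogonal (h r hr.1) hy

/-- Exponential decay for mild solutions that are continuous on the whole real line. -/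
lemma waveEnergy_le_of_continuous {d : W₁ →ₗ.[ℝ] W₂} (hdense : Dense (d.domain : Set W₁))
    (hclosed : d.IsClosed) (hrange : IsClosed (LinearMap.range d.toFun : Set W₂))
    {α β : W₁ ≃L[ℝ] W₁} {γ : W₂ ≃L[ℝ] W₂}
    (hα : (α : W₁ →L[ℝ] W₁).IsPositive) (hβ : (β : W₁ →L[ℝ] W₁).IsPositive)
    (hγ : (γ : W₂ →L[ℝ] W₂).IsPositive) {c C P : ℝ} (hc : IsNormEquivConst α β c C)
    (hP : IsPoincareConst d α β γ P) {u : ℝ → W₁} {v : ℝ → W₂} (hu : Continuous u)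
    (hv : Continuous v) (hsol : IsMildSolution d α β γ u v)
    (hv0 : γ (v 0) ∈ LinearMap.range d.toFun) {s t : ℝ} (hs : 0 ≤ s) (hst : s ≤ t) :
    waveEnergy α γ (u t) (v t) ≤ 3 * Real.exp (-(2 / 3 * deltaStarStar c C P) * (t - s)) *
      waveEnergy α γ (u s) (v s) := by
  let U : ℝ → W₁ := fun t => ∫ r in (0 : ℝ)..t, u r
  let V : ℝ → W₂ := fun t => ∫ r in (0 : ℝ)..t, v r
  have hU : ∀ t, HasDerivAt U (u t) t := fun t => (hu.integral_hasStrictDerivAt 0 t).hasDerivAt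
  have hV : ∀ t, HasDerivAt V (v t) t := fun t => (hv.integral_hasStrictDerivAt 0 t).hasDerivAt
  have hmild : ∀ t, 0 ≤ t → ∃ (x : d.domain) (y : d.adjoint.domain), (x : W₁) = U t ∧
      (y : W₂) = V t ∧ α (u t - u 0) = d.adjoint y - β (x : W₁) ∧ γ (v t - v 0) = -d x :=
    hsol.integral_eq
  have hvr : ∀ t, 0 ≤ t → γ (v t) ∈ LinearMap.range d.toFun := by
    intro t ht
    obtain ⟨x, -, -, -, -, h⟩ := hmild t ht
    have h' : γ (v t) = γ (v 0) - d x := by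
      rw [sub_eq_add_neg, ← h, map_sub]
      abel
    rw [h']
    exact Submodule.sub_mem _ hv0 ⟨x, rfl⟩
  have hVr : ∀ t h, 0 ≤ t → 0 < h → γ (V (t + h) - V t) ∈ LinearMap.range d.toFun := by
    intro t h ht hh
    have h1 : V (t + h) - V t = ∫ r in t..(t + h), v r :=
      intervalIntegral.integral_interval_sub_left (hv.intervalIntegrable _ _)
        (hv.intervalIntegrable _ _)
    have h2 := (γ : W₂ →L[ℝ] W₂).intervalIntegral_comp_comm
      (hv.intervalIntegrable (μ := MeasureTheory.volume) t (t + h))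
    simp only [ContinuousLinearEquiv.coe_coe] at h2
    rw [h1, ← h2]
    exact intervalIntegral_mem_of_isClosed hrange (γ.continuous.comp hv) (by linarith)
      fun r hr => hvr r (ht.trans hr)
  clear_value U V
  -- Subtracting the mild identities at `t` and `t + h` shows that the quotients satisfy the system
  -- in the strong sense.
  have hdecay : ∀ h : ℝ, 0 < h →
      waveEnergy α γ (h⁻¹ • (U (t + h) - U t)) (h⁻¹ • (V (t + h) - V t)) ≤
        3 * Real.exp (-(2 / 3 * deltaStarStar c C P) * (t - s)) *
          waveEnergy α γ (h⁻¹ • (U (s + h) - U s)) (h⁻¹ • (V (s + h) - V s)) := by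
    intro h hh
    refine waveEnergy_le_of_hasDerivAt (u := fun t => h⁻¹ • (U (t + h) - U t))
      (v := fun t => h⁻¹ • (V (t + h) - V t)) (u' := fun t => h⁻¹ • (u (t + h) - u t))
      (v' := fun t => h⁻¹ • (v (t + h) - v t)) hdense hclosed hrange hα hβ hγ hc hP
      (fun t => ?_) (fun t => ?_) (fun t ht => ?_) (fun t ht => ?_) hs hst
    · exact (((hU (t + h)).comp_add_const t h).sub (hU t)).const_smul h⁻¹
    · exact (((hV (t + h)).comp_add_const t h).sub (hV t)).const_smul h⁻¹
    · obtain ⟨x, y, hx, hy, h1, h2⟩ := hmild t ht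
      obtain ⟨x', y', hx', hy', h1', h2'⟩ := hmild (t + h) (by positivity)
      refine ⟨h⁻¹ • (x' - x), h⁻¹ • (y' - y), ?_, ?_, ?_, ?_⟩
      · rw [Submodule.coe_smul, Submodule.coe_sub, hx, hx']
      · rw [Submodule.coe_smul, Submodule.coe_sub, hy, hy']
      · have h3 : u (t + h) - u t = (u (t + h) - u 0) - (u t - u 0) := by abel
        rw [h3, map_smul, map_sub, h1, h1', LinearPMap.map_smul, LinearPMap.map_sub,
          Submodule.coe_smul, Submodule.coe_sub, map_smul, map_sub, ← smul_sub]
        congr 1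
        abel
      · have h3 : v (t + h) - v t = (v (t + h) - v 0) - (v t - v 0) := by abel
        rw [h3, map_smul, map_sub, h2, h2', LinearPMap.map_smul, LinearPMap.map_sub, ← smul_neg]
        congr 1
        abel
    · rw [map_smul]
      exact Submodule.smul_mem _ _ (hVr t h ht hh)
  refine le_of_tendsto_of_tendsto (tendsto_waveEnergy_slope hα hγ (hU t) (hV t))
    ((tendsto_waveEnergy_slope hα hγ (hU s) (hV s)).const_mul _) ?_
  filter_upwards [self_mem_nhdsWithin] with h hh using hdecay h hh

end Decay

theorem theorem1 {W₁ W₂ : Type*}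
    [NormedAddCommGroup W₁] [InnerProductSpace ℝ W₁] [CompleteSpace W₁]
    [NormedAddCommGroup W₂] [InnerProductSpace ℝ W₂] [CompleteSpace W₂]
    (d : W₁ →ₗ.[ℝ] W₂) (hd_dense : Dense (d.domain : Set W₁)) (hd_closed : d.IsClosed)
    (hd_range : IsClosed (LinearMap.range d.toFun : Set W₂))
    (α β : W₁ ≃L[ℝ] W₁) (γ : W₂ ≃L[ℝ] W₂)
    (hα : (α : W₁ →L[ℝ] W₁).IsPositive) (hβ : (β : W₁ →L[ℝ] W₁).IsPositive)
    (hγ : (γ : W₂ →L[ℝ] W₂).IsPositive) :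
    (∃ c C P : ℝ, IsNormEquivConst α β c C ∧ IsPoincareConst d α β γ P) ∧
    ∀ c C P : ℝ, IsNormEquivConst α β c C → IsPoincareConst d α β γ P →
      0 < deltaStarStar c C P ∧
      ∀ (u : ℝ → W₁) (v : ℝ → W₂), IsMildSolution d α β γ u v →
        γ (v 0) ∈ LinearMap.range d.toFun →
        ∀ s t : ℝ, 0 ≤ s → s ≤ t →
          waveEnergy α γ (u t) (v t) ≤
            3 * Real.exp (-(2 / 3 * deltaStarStar c C P) * (t - s)) *
              waveEnergy α γ (u s) (v s) := by
  refine ⟨?_, fun c C P hc hP => ⟨deltaStarStar_pos hc.pos hc.le hP.nonneg, ?_⟩⟩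
  · obtain ⟨c, C, hc⟩ := exists_isNormEquivConst hα hβ
    obtain ⟨P, hP⟩ := exists_isPoincareConst hd_closed hd_range hα hβ hγ
    exact ⟨c, C, P, hc, hP⟩
  intro u₀ v₀ hsol hv0 s t hs hst
  -- Freezing the solution for negative times gives continuity on the whole line, hence primitives
  -- with two-sided derivatives at `0`.
  let u : ℝ → W₁ := fun r => u₀ (max r 0)
  let v : ℝ → W₂ := fun r => v₀ (max r 0)
  have hmax : Continuous fun r : ℝ => max r 0 := continuous_id.max continuous_const
  have hu : Continuous u :=
    hsol.continuousOn_fst.comp_continuous hmax fun r => le_max_right r 0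
  have hv : Continuous v :=
    hsol.continuousOn_snd.comp_continuous hmax fun r => le_max_right r 0
  have hueq : ∀ r, 0 ≤ r → u r = u₀ r := fun r hr => congrArg u₀ (max_eq_left hr)
  have hveq : ∀ r, 0 ≤ r → v r = v₀ r := fun r hr => congrArg v₀ (max_eq_left hr)
  have hsol' : IsMildSolution d α β γ u v := by
    refine ⟨hu.continuousOn, hv.continuousOn, fun t ht => ?_⟩
    obtain ⟨x, y, hx, hy, h1, h2⟩ := hsol.integral_eq t ht
    rw [← hueq t ht, ← hueq 0 le_rfl] at h1
    rw [← hveq t ht, ← hveq 0 le_rfl] at h2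
    refine ⟨x, y, hx.trans ?_, hy.trans ?_, h1, h2⟩
    · refine intervalIntegral.integral_congr fun r hr => ?_
      rw [Set.uIcc_of_le ht] at hr
      exact (hueq r hr.1).symm
    · refine intervalIntegral.integral_congr fun r hr => ?_
      rw [Set.uIcc_of_le ht] at hr
      exact (hveq r hr.1).symm
  rw [← hueq t (hs.trans hst), ← hveq t (hs.trans hst), ← hueq s hs, ← hveq s hs]
  rw [← hveq 0 le_rfl] at hv0
  exact waveEnergy_le_of_continuous hd_dense hd_closed hd_range hα hβ hγ hc hP hu hv hsol' hv0 hs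
    hst
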